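/- Let $\mathbb{K}$ be a field of characteristic zero and let $\mathcal{H}=\bigoplus_{n\ge 0}\mathcal{H}_n$ be a connected graded Hopf algebra over $\mathbb{K}$ (so $\mathcal{H}_0=\mathbb{K}1$), with coproduct $\Delta$, counit $\varepsilon$ and antipode $S$. Let $\mathcal{A}=\mathrm{Hom}(\mathcal{H},\mathbb{K})$ with the convolution product $f\star g=m_{\mathbb{K}}\circ(f\otimes g)\circ\Delta$ and unit $\varepsilon$. It is a complete filtered algebra for the filtration $\mathcal{A}_n=\{f : f|_{\mathcal{H}_i}=0 \text{ for all } i<n\}$, and $\exp:\mathcal{A}_1\to\varepsilon+\mathcal{A}_1$ and $\log:\varepsilon+\mathcal{A}_1\to\mathcal{A}_1$ denote the usual series, convergent for this filtration. For $x,y\in\mathcal{A}_1$ put $\mathrm{BCH}(x,y)=\log(\exp(x)\star\exp(y))-x-y$. Let $G\subset\mathcal{A}$ be the group of characters (unital algebra homomorphisms $\mathcal{H}\to\mathbb{K}$), and let $\mathfrak{g}\subset\mathcal{A}_1$ be the space of infinitesimal characters, i.e. of $Z\in\mathcal{A}$ with $Z(xy)=Z(x)\varepsilon(y)+\varepsilon(x)Z(y)$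 for all $x,y\in\mathcal{H}$. Let $\bar h=(-1)^n h$ for $h\in\mathcal{H}_n$, extended linearly, and $\bar f(h)=f(\bar h)$ for $f\in\mathcal{A}$. A character $\phi$ is even if $\bar\phi=\phi$ and odd if $\bar\phi=\phi^{-1}=\phi\circ S$. Let $\pi_-$ and $\pi_+$ be the projections of $\mathcal{H}$ onto $\bigoplus_{n\text{ odd}}\mathcal{H}_n$ and $\bigoplus_{n\text{ even}}\mathcal{H}_n$ along each other, and write $f_\pm=f\circ\pi_\pm$ for $f\in\mathcal{A}$. For $Z\in\mathfrak{g}$ let $\chi_{(0)}(Z)=Z$ and $$\chi_{(n+1)}(Z)=Z-\mathrm{BCH}\big(\chi_{(n)}(Z)_-,\,\chi_{(n)}(Z)_+\big),\qquad \chi(Z)=\lim_{n\to\infty}\chi_{(n)}(Z).$$ Then for every character $\phi\in G$: 1. $\phi$ has a unique decomposition $\phi=\phi_-\star\phi_+$ with $\phi_-$ an odd character and $\phi_+$ an even character. 2. There is a unique $Z\in\mathfrak{g}$ with $\phi=\exp(Z)$. 3. For this $Z$, the sequence $\chi_{(n)}(Z)$ converges, its limit $\chi(Z)$ lies in $\mathfrak{g}$,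 one has $\phi=\exp(\chi(Z)_-)\star\exp(\chi(Z)_+)$, and this factorization coincides with the one in 1: $\phi_-=\exp(\chi(Z)_-)$ and $\phi_+=\exp(\chi(Z)_+)$. -/

import Mathlib

noncomputable section

/-! ### Complete filtered algebras, exponential, logarithm and the BCH-recursion -/

namespace FilteredAlg

variable {K A : Type*} [Field K] [Ring A] [Algebra K A]

/-- The sequence `s` converges to `a` in the topology given by the decreasing filtration `F`. -/
def Converges (F : ℕ → Submodule K A) (s : ℕ → A) (a : A) : Prop :=
  ∀ n, ∃ N, ∀ m, N ≤ m → s m - a ∈ F n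

/-- The limit of the sequence `s` for the topology given by `F`
(an arbitrary element if `s` does not converge). -/
def limit (F : ℕ → Submodule K A) (s : ℕ → A) : A :=
  Classical.epsilon fun a => Converges F s a

/-- `F` is a decreasing multiplicative filtration of `A`, and the canonical map from `A` to the
inverse limit of the `A / F n` is injective (`separated`) and surjective (`complete`). -/
structure IsCompleteFiltration (F : ℕ → Submodule K A) : Prop where
  zero : F 0 = ⊤
  anti : Antitone F
  mul_mem : ∀ m n a b, a ∈ F m → b ∈ F n → a * b ∈ F (m + n)
  separated : ∀ a, (∀ n, a ∈ F n) → a = 0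
  complete : ∀ s : ℕ → A, (∀ n, s (n + 1) - s n ∈ F n) → ∃ a, ∀ n, s n - a ∈ F n

/-- Partial sums of `exp a = ∑ aⁿ / n!`. -/
def expSum (K : Type*) {A : Type*} [Field K] [Ring A] [Algebra K A] (a : A) (N : ℕ) : A :=
  ∑ k ∈ Finset.range N, (k.factorial : K)⁻¹ • a ^ k

/-- The exponential `A₁ → 1 + A₁`. -/
def exp (F : ℕ → Submodule K A) (a : A) : A := limit F (expSum K a)

/-- Partial sums of `log (1 + a) = - ∑_{n ≥ 1} (-a)ⁿ / n`, as a function of `b = 1 + a`. -/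
def logSum (K : Type*) {A : Type*} [Field K] [Ring A] [Algebra K A] (b : A) (N : ℕ) : A :=
  - ∑ k ∈ Finset.range N, ((k + 1 : ℕ) : K)⁻¹ • (1 - b) ^ (k + 1)

/-- The logarithm `1 + A₁ → A₁`. -/
def log (F : ℕ → Submodule K A) (b : A) : A := limit F (logSum K b)

/-- `C(x, y) = log (exp x * exp y)`. -/
def C (F : ℕ → Submodule K A) (x y : A) : A := log F (exp F x * exp F y)

/-- The Baker–Campbell–Hausdorff series, without its linear terms:
`exp x * exp y = exp (x + y + BCH (x, y))`. -/
def BCH (F : ℕ → Submodule K A) (x y : A) : A := C F x y - x - y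

/-- The iterates `χ₍ₙ₎(a)` of the BCH-recursion attached to `P`. -/
def chiSeq (F : ℕ → Submodule K A) (P : A →ₗ[K] A) (a : A) : ℕ → A
  | 0 => a
  | n + 1 => a - BCH F (P (chiSeq F P a n)) ((LinearMap.id - P : A →ₗ[K] A) (chiSeq F P a n))

/-- The BCH-recursion map `χ(a) = lim χ₍ₙ₎(a)` attached to `P`. -/
def chi (F : ℕ → Submodule K A) (P : A →ₗ[K] A) (a : A) : A := limit F (chiSeq F P a)

theorem Converges.unique {F : ℕ → Submodule K A} (hF : IsCompleteFiltration F)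
    {s : ℕ → A} {a b : A} (ha : Converges F s a) (hb : Converges F s b) : a = b := by
  refine sub_eq_zero.mp (hF.separated _ fun n => ?_)
  obtain ⟨N, hN⟩ := ha n
  obtain ⟨M, hM⟩ := hb n
  have := (F n).sub_mem (hM (max N M) (le_max_right _ _)) (hN (max N M) (le_max_left _ _))
  simpa using this

theorem converges_lim {F : ℕ → Submodule K A} {s : ℕ → A} (h : ∃ a, Converges F s a) :
    Converges F s (limit F s) := Classical.epsilon_spec h

theorem converges_of_complete {F : ℕ → Submodule K A} (hF : IsCompleteFiltration F) {s : ℕ → A}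
    (h : ∀ n, s (n + 1) - s n ∈ F n) : Converges F s (limit F s) := by
  obtain ⟨a, ha⟩ := hF.complete s h
  exact converges_lim ⟨a, fun n => ⟨n, fun m hm => hF.anti hm (ha m)⟩⟩

theorem pow_mem {F : ℕ → Submodule K A} (hF : IsCompleteFiltration F) {a : A} (ha : a ∈ F 1) :
    ∀ n, a ^ n ∈ F n
  | 0 => by rw [hF.zero]; trivial
  | n + 1 => by rw [pow_succ]; exact hF.mul_mem _ _ _ _ (pow_mem hF ha n) ha

/-- The exponential series converges on `A₁`. -/
theorem converges_exp {F : ℕ → Submodule K A} (hF : IsCompleteFiltration F) {a : A}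
    (ha : a ∈ F 1) : Converges F (expSum K a) (exp F a) := by
  refine converges_of_complete hF fun n => ?_
  simp only [expSum, Finset.sum_range_succ, add_sub_cancel_left]
  exact (F n).smul_mem _ (pow_mem hF ha n)

/-- The logarithm series converges on `1 + A₁`. -/
theorem converges_log {F : ℕ → Submodule K A} (hF : IsCompleteFiltration F) {b : A}
    (hb : b - 1 ∈ F 1) : Converges F (logSum K b) (log F b) := by
  refine converges_of_complete hF fun n => ?_
  have h1 : 1 - b ∈ F 1 := by simpa using (F 1).neg_mem hb
  have h2 : logSum K b (n + 1) - logSum K b n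
      = -(((n + 1 : ℕ) : K)⁻¹ • (1 - b) ^ (n + 1)) := by
    simp only [logSum, Finset.sum_range_succ]; abel
  rw [h2]
  exact (F n).neg_mem ((F n).smul_mem _ (hF.anti n.le_succ (pow_mem hF h1 (n + 1))))

end FilteredAlg

/-! ### Connected graded Hopf algebras and their characters -/

namespace GradedHopf

variable {K H : Type*} [Field K] [Ring H] [HopfAlgebra K H]

/-- The grading `𝒜` of the algebra `H` makes the Hopf algebra `H` a connected graded Hopf algebra:
the coproduct and the counit are homogeneous of degree `0`, and `H₀ = K · 1`.
(The antipode then preserves degrees automatically.) -/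
structure IsConnectedGraded (𝒜 : ℕ → Submodule K H) : Prop where
  comul_mem : ∀ n, ∀ x ∈ 𝒜 n, Coalgebra.comul (R := K) x ∈
    ⨆ p ∈ Finset.HasAntidiagonal.antidiagonal n,
      LinearMap.range (TensorProduct.map (𝒜 p.1).subtype (𝒜 p.2).subtype)
  counit_eq_zero : ∀ n, n ≠ 0 → ∀ x ∈ 𝒜 n, Coalgebra.counit (R := K) x = 0
  connected : 𝒜 0 = Submodule.span K {1}

variable (𝒜 : ℕ → Submodule K H) [GradedAlgebra 𝒜]

/-- The linear endomorphism of `H` that multiplies elements of degree `n` by `c n`. -/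
def degreeScale (c : ℕ → K) : H →ₗ[K] H :=
  DirectSum.toModule K ℕ H (fun n => c n • (𝒜 n).subtype) ∘ₗ
    (DirectSum.decomposeLinearEquiv 𝒜).toLinearMap

theorem degreeScale_apply (c : ℕ → K) {n : ℕ} {x : H} (hx : x ∈ 𝒜 n) :
    degreeScale 𝒜 c x = c n • x := by
  simp only [degreeScale, LinearMap.comp_apply, LinearEquiv.coe_coe,
    DirectSum.decomposeLinearEquiv_apply]
  rw [DirectSum.decompose_of_mem 𝒜 hx, ← DirectSum.lof_eq_of K, DirectSum.toModule_lof]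
  simp

/-- The grading involution `h ↦ (-1)^|h| h`. -/
def bar : H →ₗ[K] H := degreeScale 𝒜 fun n => (-1) ^ n

/-- The projection `π₋` of `H` onto the sum of its components of odd degree. -/
def oddProj : H →ₗ[K] H := degreeScale 𝒜 fun n => if Odd n then 1 else 0

/-- The projection `π₊` of `H` onto the sum of its components of even degree. -/
def evenProj : H →ₗ[K] H := degreeScale 𝒜 fun n => if Even n then 1 else 0

/-- `Hom(H, K)` with the convolution product. -/
abbrev Dual (K H : Type*) [Field K] [Ring H] [HopfAlgebra K H] : Type _ :=
  WithConv (H →ₗ[K] K)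

/-- The characters of `H` with the convolution product. -/
abbrev Character (K H : Type*) [Field K] [Ring H] [HopfAlgebra K H] : Type _ :=
  WithConv (H →ₐ[K] K)

/-- A character seen as an element of the convolution algebra `Hom(H, K)`. -/
def Character.toDual (φ : Character K H) : Dual K H := WithConv.toConv φ.ofConv.toLinearMap

/-- Precomposition with an endomorphism of `H`, as an endomorphism of `Hom(H, K)`. -/
def precomp (j : H →ₗ[K] H) : Dual K H →ₗ[K] Dual K H where
  toFun f := WithConv.toConv (f.ofConv ∘ₗ j)
  map_add' _ _ := rfl
  map_smul' _ _ := rfl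

/-- The filtration of `Hom(H, K)` induced by the grading of `H`: the `n`-th step consists of the
linear forms that vanish in all degrees `< n`. -/
def dualFiltration (n : ℕ) : Submodule K (Dual K H) where
  carrier := {f | ∀ i < n, ∀ x ∈ 𝒜 i, f x = 0}
  add_mem' {f g} hf hg i hi x hx := by
    change f x + g x = 0
    rw [hf i hi x hx, hg i hi x hx, add_zero]
  zero_mem' _ _ _ _ := rfl
  smul_mem' c f hf i hi x hx := by
    change c • f x = 0
    rw [hf i hi x hx, smul_zero]

/-- The Lie algebra `∂Char(H, K)` of infinitesimal characters (`ε`-derivations). -/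
def infChar (K H : Type*) [Field K] [Ring H] [HopfAlgebra K H] : Submodule K (Dual K H) where
  carrier := {Z | ∀ x y : H, Z (x * y) =
    Z x * Coalgebra.counit (R := K) y + Coalgebra.counit (R := K) x * Z y}
  add_mem' {f g} hf hg x y := by
    change f (x * y) + g (x * y) = (f x + g x) * _ + _ * (f y + g y)
    rw [hf x y, hg x y]; ring
  zero_mem' x y := by
    change (0 : K) = 0 * _ + _ * 0
    simp
  smul_mem' c f hf x y := by
    change c * f (x * y) = (c * f x) * _ + _ * (c * f y)
    rw [hf x y]; ring

/-- The character `φ` is even: `φ̄ = φ`. -/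
def IsEven (φ : Character K H) : Prop := precomp (bar 𝒜) φ.toDual = φ.toDual

/-- The character `φ` is odd: `φ̄ = φ⁻¹ = φ ∘ S`. -/
def IsOdd (φ : Character K H) : Prop :=
  precomp (bar 𝒜) φ.toDual = precomp (HopfAlgebra.antipode K) φ.toDual

/-- `p = (φ₋, φ₊)` is a factorization `φ = φ₋ ⋆ φ₊` with `φ₋` odd and `φ₊` even. -/
def IsOddEvenFactorization (φ : Character K H) (p : Character K H × Character K H) : Prop :=
  IsOdd 𝒜 p.1 ∧ IsEven 𝒜 p.2 ∧ φ = p.1 * p.2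

/-- `φ ∘ S` is the convolution inverse of the character `φ`. -/
theorem toDual_mul_antipode (φ : Character K H) :
    φ.toDual * precomp (HopfAlgebra.antipode K) φ.toDual = 1 ∧
      precomp (HopfAlgebra.antipode K) φ.toDual * φ.toDual = 1 := by
  constructor
  · have h := LinearMap.algHom_comp_convMul_distrib (R := K) φ.ofConv
      (WithConv.toConv LinearMap.id) (WithConv.toConv (HopfAlgebra.antipode K (A := H)))
    rw [LinearMap.id_mul_antipode] at h
    refine WithConv.ext (Eq.trans h.symm (LinearMap.ext fun x => ?_))
    simp [LinearMap.convOne_def]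
  · have h := LinearMap.algHom_comp_convMul_distrib (R := K) φ.ofConv
      (WithConv.toConv (HopfAlgebra.antipode K (A := H))) (WithConv.toConv LinearMap.id)
    rw [LinearMap.antipode_mul_id] at h
    refine WithConv.ext (Eq.trans h.symm (LinearMap.ext fun x => ?_))
    simp [LinearMap.convOne_def]

/-- The convolution algebra `Hom(H, K)` is a complete filtered algebra. -/
theorem dualFiltration_isComplete (h𝒜 : IsConnectedGraded 𝒜) :
    FilteredAlg.IsCompleteFiltration (dualFiltration 𝒜) where
  zero := by
    ext f; simp [dualFiltration]
  anti m n hmn f hf i hi x hx := hf i (hi.trans_le hmn) x hx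
  mul_mem m n f g hf hg i hi x hx := by
    have key : ∀ t ∈ ⨆ p ∈ Finset.HasAntidiagonal.antidiagonal i,
        LinearMap.range (TensorProduct.map (𝒜 p.1).subtype (𝒜 p.2).subtype),
        LinearMap.mul' K K (TensorProduct.map f.ofConv g.ofConv t) = 0 := by
      intro t ht
      have hle : (⨆ p ∈ Finset.HasAntidiagonal.antidiagonal i,
          LinearMap.range (TensorProduct.map (𝒜 p.1).subtype (𝒜 p.2).subtype)) ≤
          LinearMap.ker (LinearMap.mul' K K ∘ₗ TensorProduct.map f.ofConv g.ofConv) := by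
        refine iSup₂_le fun p hp => ?_
        rw [LinearMap.range_le_ker_iff]
        ext a b
        have hpi := Finset.HasAntidiagonal.mem_antidiagonal.mp hp
        rcases lt_or_ge p.1 m with h1 | h1
        · have := hf p.1 h1 a a.2
          simp [this]
        · have := hg p.2 (by omega) b b.2
          simp [this]
      simpa using hle ht
    exact key _ (h𝒜.comul_mem i x hx)
  separated f hf := by
    refine WithConv.ext (LinearMap.ext fun x => ?_)
    induction x using DirectSum.Decomposition.inductionOn 𝒜 with
    | zero => simp
    | homogeneous a => exact hf _ _ (Nat.lt_succ_self _) a a.2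
    | add a b ha hb => rw [map_add, map_add, ha, hb]
  complete s hs := by
    refine ⟨WithConv.toConv (DirectSum.toModule K ℕ K
      (fun d => (s (d + 1)).ofConv ∘ₗ (𝒜 d).subtype) ∘ₗ
        (DirectSum.decomposeLinearEquiv 𝒜).toLinearMap), fun n i hi x hx => ?_⟩
    have hstep : ∀ k, i + 1 ≤ k → s k x = s (i + 1) x := by
      intro k hk
      induction k, hk using Nat.le_induction with
      | base => rfl
      | succ k hk ih =>
        have h : s (k + 1) x - s k x = 0 := hs k i hk x hx
        rw [← ih, sub_eq_zero.mp h]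
    change s n x - _ = 0
    rw [hstep n hi, sub_eq_zero]
    change s (i + 1) x = DirectSum.toModule K ℕ K
      (fun d => (s (d + 1)).ofConv ∘ₗ (𝒜 d).subtype) (DirectSum.decompose 𝒜 x)
    rw [DirectSum.decompose_of_mem 𝒜 hx, ← DirectSum.lof_eq_of K, DirectSum.toModule_lof]
    rfl

end GradedHopf

end

open GradedHopf

/-! ### Convergence rates and filtration estimates -/

namespace FilteredAlg

open Polynomial

variable {K A : Type*} [Field K] [Ring A] [Algebra K A] {F : ℕ → Submodule K A}

/-! If φ = φ₋ ⋆ φ₊, then φ̄ = φ₋⁻¹ ⋆ φ₊, so φ₋² = φ ⋆ φ̄⁻¹. Square roots in 1 + A₁ are unique, which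
gives uniqueness. Conversely ψ = φ ⋆ φ̄⁻¹ satisfies ψ̄ = ψ⁻¹, so its logarithm W is odd; φ₋ =
exp(W/2) and φ₊ = φ₋⁻¹ ⋆ φ work, provided exp(W/2) is a character.

That, and the fact that logarithms of characters are infinitesimal characters, come from
`exp_smul_map_mul_and_mem_infChar`: on a fixed element of H, exp(tZ) is polynomial in t, and it is
multiplicative at every natural t because exp(nZ) = φⁿ. Hence it is multiplicative for all t, and
the coefficient of t gives the derivation rule.

For the recursion, X = log φ₋ is odd and Y = log φ₊ is even, so b = X + Y has b₋ = X, b₊ = Y and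
log(exp b₋ ⋆ exp b₊) = Z. Thus b is a fixed point of b ↦ Z − BCH(b₋, b₊), and `BCH_sub_BCH_mem`
makes this map contracting, so the iterates converge to b. No Lie-series form of BCH is needed: b
lies in 𝔤 as a sum of two logarithms of characters. -/

theorem Converges.sub_mem (hF : IsCompleteFiltration F) {s : ℕ → A} {a : A}
    (hs : ∀ n, s (n + 1) - s n ∈ F n) (h : Converges F s a) (n : ℕ) : s n - a ∈ F n := by
  have step : ∀ m, n ≤ m → s m - s n ∈ F n := by
    intro m hm
    induction m, hm using Nat.le_induction with
    | base => simp
    | succ m hm ih =>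
      have := (F n).add_mem (hF.anti hm (hs m)) ih
      simpa using this
  obtain ⟨N, hN⟩ := h n
  have := (F n).sub_mem (hN (max N n) (le_max_left _ _)) (step (max N n) (le_max_right _ _))
  simpa using this

theorem eq_of_forall_sub_mem (hF : IsCompleteFiltration F) {a b : A} (h : ∀ n, a - b ∈ F n) :
    a = b := sub_eq_zero.mp (hF.separated _ h)

theorem limit_eq (hF : IsCompleteFiltration F) {s : ℕ → A} {a : A} (h : Converges F s a) :
    limit F s = a := Converges.unique hF (converges_lim ⟨a, h⟩) h

theorem mul_mem_left (hF : IsCompleteFiltration F) {n : ℕ} (a : A) {b : A} (hb : b ∈ F n) :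
    a * b ∈ F n := by
  have := hF.mul_mem 0 n a b (by rw [hF.zero]; trivial) hb
  rwa [zero_add] at this

theorem mul_mem_right (hF : IsCompleteFiltration F) {n : ℕ} {a : A} (b : A) (ha : a ∈ F n) :
    a * b ∈ F n := by
  simpa using hF.mul_mem n 0 a b ha (by rw [hF.zero]; trivial)

theorem mul_sub_mul_mem (hF : IsCompleteFiltration F) {n : ℕ} {a a' b b' : A}
    (ha : a - a' ∈ F n) (hb : b - b' ∈ F n) : a * b - a' * b' ∈ F n := by
  have := (F n).add_mem (mul_mem_right hF b ha) (mul_mem_left hF a' hb)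
  convert this using 1
  noncomm_ring

theorem pow_sub_pow_mem (hF : IsCompleteFiltration F) {n : ℕ} {a b : A}
    (ha : a ∈ F 1) (hb : b ∈ F 1) (h : a - b ∈ F n) :
    ∀ k, a ^ (k + 1) - b ^ (k + 1) ∈ F (n + k)
  | 0 => by simpa using h
  | k + 1 => by
    have h1 := hF.mul_mem _ _ _ _ (pow_mem hF ha (k + 1)) h
    have h2 := hF.mul_mem _ _ _ _ (pow_sub_pow_mem hF ha hb h k) hb
    rw [show k + 1 + n = n + (k + 1) by omega] at h1
    rw [show n + k + 1 = n + (k + 1) by omega] at h2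
    have := (F _).add_mem h1 h2
    convert this using 1
    rw [pow_succ a (k + 1), pow_succ b (k + 1)]
    noncomm_ring

/-- Transfers polynomial congruences modulo `X ^ n` to congruences modulo `F n`, so identities
between series can be checked on truncations. -/
theorem aeval_mem (hF : IsCompleteFiltration F) {a : A} (ha : a ∈ F 1) {n : ℕ} {p : K[X]}
    (hp : X ^ n ∣ p) : aeval a p ∈ F n := by
  obtain ⟨q, rfl⟩ := hp
  rw [map_mul, map_pow, aeval_X]
  exact mul_mem_right hF _ (pow_mem hF ha n)

/-! ### The exponential and the logarithm -/

theorem map_expSum {B : Type*} [Ring B] [Algebra K B] (σ : A →ₐ[K] B) (a : A) (N : ℕ) :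
    σ (expSum K a N) = expSum K (σ a) N := by
  simp [expSum]

theorem map_logSum {B : Type*} [Ring B] [Algebra K B] (σ : A →ₐ[K] B) (a : A) (N : ℕ) :
    σ (logSum K a N) = logSum K (σ a) N := by
  simp [logSum]

theorem expSum_sub_exp_mem (hF : IsCompleteFiltration F) {a : A} (ha : a ∈ F 1) (n : ℕ) :
    expSum K a n - exp F a ∈ F n := by
  refine Converges.sub_mem hF (fun n => ?_) (converges_exp hF ha) n
  simp only [expSum, Finset.sum_range_succ, add_sub_cancel_left]
  exact (F n).smul_mem _ (pow_mem hF ha n)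

theorem logSum_sub_log_mem (hF : IsCompleteFiltration F) {b : A} (hb : b - 1 ∈ F 1) (n : ℕ) :
    logSum K b n - log F b ∈ F n := by
  refine Converges.sub_mem hF (fun n => ?_) (converges_log hF hb) n
  have h1 : 1 - b ∈ F 1 := by simpa using (F 1).neg_mem hb
  have h2 : logSum K b (n + 1) - logSum K b n
      = -(((n + 1 : ℕ) : K)⁻¹ • (1 - b) ^ (n + 1)) := by
    simp only [logSum, Finset.sum_range_succ]; abel
  rw [h2]
  exact (F n).neg_mem ((F n).smul_mem _ (hF.anti n.le_succ (pow_mem hF h1 (n + 1))))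

theorem exp_sub_one_mem (hF : IsCompleteFiltration F) {a : A} (ha : a ∈ F 1) :
    exp F a - 1 ∈ F 1 := by
  simpa [expSum] using (F 1).neg_mem (expSum_sub_exp_mem hF ha 1)

theorem log_mem (hF : IsCompleteFiltration F) {b : A} (hb : b - 1 ∈ F 1) : log F b ∈ F 1 := by
  have := (F 1).sub_mem hb (logSum_sub_log_mem hF hb 1)
  simpa [logSum] using this

theorem mul_sub_one_mem {n : ℕ} (hF : IsCompleteFiltration F) {a b : A} (ha : a - 1 ∈ F n)
    (hb : b - 1 ∈ F n) : a * b - 1 ∈ F n := by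
  simpa using mul_sub_mul_mem hF ha hb

theorem exp_zero (hF : IsCompleteFiltration F) : exp F (0 : A) = 1 := by
  refine limit_eq hF fun n => ⟨1, fun m hm => ?_⟩
  obtain ⟨m, rfl⟩ := Nat.exists_eq_add_of_le' hm
  simp [expSum, Finset.sum_range_succ']

/-- An algebra endomorphism that preserves the filtration commutes with the exponential. -/
theorem map_exp (hF : IsCompleteFiltration F) (σ : A →ₐ[K] A) (hσ : ∀ n, ∀ a ∈ F n, σ a ∈ F n)
    {a : A} (ha : a ∈ F 1) : σ (exp F a) = exp F (σ a) := by
  refine eq_of_forall_sub_mem hF fun n => ?_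
  have h1 := hσ n _ (expSum_sub_exp_mem hF ha n)
  have h2 := expSum_sub_exp_mem hF (hσ 1 _ ha) n
  rw [map_sub, map_expSum] at h1
  simpa using (F n).sub_mem h2 h1

/-- Every term of degree at least 2 carries an extra factor from `F 1`, so to leading order exp acts
on differences as the identity. Injectivity of exp follows by induction on the filtration degree. -/
theorem exp_sub_exp_sub_mem (hF : IsCompleteFiltration F) {n : ℕ} {a b : A} (ha : a ∈ F 1)
    (hb : b ∈ F 1) (h : a - b ∈ F n) : exp F a - exp F b - (a - b) ∈ F (n + 1) := by
  -- Length `n + 2` keeps the linear term in the truncation even for `n = 0`.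
  have h1 := hF.anti (Nat.le_succ (n + 1)) (expSum_sub_exp_mem hF ha (n + 2))
  have h2 := hF.anti (Nat.le_succ (n + 1)) (expSum_sub_exp_mem hF hb (n + 2))
  have h3 : expSum K a (n + 2) - expSum K b (n + 2) - (a - b) ∈ F (n + 1) := by
    have : expSum K a (n + 2) - expSum K b (n + 2) - (a - b) =
        ∑ k ∈ Finset.range n, ((k + 2).factorial : K)⁻¹ • (a ^ (k + 2) - b ^ (k + 2)) := by
      simp only [expSum, Finset.sum_range_succ', smul_sub, Finset.sum_sub_distrib]
      simp
      abel
    rw [this]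
    refine Submodule.sum_mem _ fun k _ => Submodule.smul_mem _ _ ?_
    exact hF.anti (by omega) (pow_sub_pow_mem hF ha hb h (k + 1))
  have := (F (n + 1)).add_mem ((F (n + 1)).sub_mem h2 h1) h3
  convert this using 1
  abel

theorem log_sub_log_sub_mem (hF : IsCompleteFiltration F) {n : ℕ} {a b : A} (ha : a - 1 ∈ F 1)
    (hb : b - 1 ∈ F 1) (h : a - b ∈ F n) : log F a - log F b - (a - b) ∈ F (n + 1) := by
  have h1 := logSum_sub_log_mem hF ha (n + 1)
  have h2 := logSum_sub_log_mem hF hb (n + 1)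
  have ha' : 1 - a ∈ F 1 := by simpa using (F 1).neg_mem ha
  have hb' : 1 - b ∈ F 1 := by simpa using (F 1).neg_mem hb
  have h' : (1 - b) - (1 - a) ∈ F n := by simpa using h
  have h3 : logSum K a (n + 1) - logSum K b (n + 1) - (a - b) ∈ F (n + 1) := by
    have : logSum K a (n + 1) - logSum K b (n + 1) - (a - b) =
        ∑ k ∈ Finset.range n,
          ((k + 1 + 1 : ℕ) : K)⁻¹ • ((1 - b) ^ (k + 2) - (1 - a) ^ (k + 2)) := by
      simp only [logSum, Finset.sum_range_succ', smul_sub, Finset.sum_sub_distrib]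
      simp
      abel
    rw [this]
    refine Submodule.sum_mem _ fun k _ => Submodule.smul_mem _ _ ?_
    exact hF.anti (by omega) (pow_sub_pow_mem hF hb' ha' h' (k + 1))
  have := (F (n + 1)).add_mem ((F (n + 1)).sub_mem h2 h1) h3
  convert this using 1
  abel

theorem exp_injOn (hF : IsCompleteFiltration F) {a b : A} (ha : a ∈ F 1) (hb : b ∈ F 1)
    (h : exp F a = exp F b) : a = b := by
  refine eq_of_forall_sub_mem hF fun n => ?_
  induction n with
  | zero => rw [hF.zero]; trivial
  | succ n ih => simpa [h] using (F _).neg_mem (exp_sub_exp_sub_mem hF ha hb ih)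

theorem log_injOn (hF : IsCompleteFiltration F) {a b : A} (ha : a - 1 ∈ F 1) (hb : b - 1 ∈ F 1)
    (h : log F a = log F b) : a = b := by
  refine eq_of_forall_sub_mem hF fun n => ?_
  induction n with
  | zero => rw [hF.zero]; trivial
  | succ n ih => simpa [h] using (F _).neg_mem (log_sub_log_sub_mem hF ha hb ih)

/-! ### Formal identities: log ∘ exp and one-parameter groups -/

theorem X_pow_succ_dvd_of_derivative [CharZero K] {p : K[X]} {n : ℕ} (h0 : p.coeff 0 = 0)
    (h : X ^ n ∣ derivative p) : X ^ (n + 1) ∣ p := by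
  rw [X_pow_dvd_iff] at h ⊢
  rintro (_ | d) hd
  · exact h0
  · have := h d (by omega)
    rw [coeff_derivative] at this
    exact (mul_eq_zero.mp this).resolve_right (by exact_mod_cast d.succ_ne_zero)

theorem X_dvd_one_sub_expSum (n : ℕ) : (X : K[X]) ∣ 1 - expSum K X (n + 1) := by
  rw [X_dvd_iff]
  simp [expSum, Finset.sum_range_succ', coeff_X_pow]

theorem derivative_expSum [CharZero K] (n : ℕ) :
    derivative (expSum K (X : K[X]) (n + 1)) = expSum K X n := by
  rw [expSum, Finset.sum_range_succ', expSum]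
  simp only [derivative_add, derivative_sum, derivative_smul, derivative_X_pow, pow_zero,
    derivative_one, smul_zero, add_zero, Nat.add_sub_cancel]
  refine Finset.sum_congr rfl fun k _ => ?_
  rw [← smul_eq_C_mul, smul_smul]
  congr 1
  have : ((k + 1 : ℕ) : K) ≠ 0 := Nat.cast_ne_zero.mpr k.succ_ne_zero
  rw [Nat.factorial_succ, Nat.cast_mul]
  field_simp

theorem derivative_logSum [CharZero K] (u : K[X]) (n : ℕ) :
    derivative (logSum K u n) = (∑ k ∈ Finset.range n, (1 - u) ^ k) * derivative u := by
  rw [logSum, derivative_neg, derivative_sum, ← Finset.sum_neg_distrib, Finset.sum_mul]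
  refine Finset.sum_congr rfl fun k _ => ?_
  have : ((k + 1 : ℕ) : K) ≠ 0 := Nat.cast_ne_zero.mpr k.succ_ne_zero
  rw [derivative_smul, derivative_pow_succ, derivative_sub, derivative_one, zero_sub,
    smul_eq_C_mul, ← Nat.cast_succ, ← mul_assoc, ← mul_assoc, ← C_mul, inv_mul_cancel₀ this]
  simp

/-- Differentiate: for u the truncated exponential, (log u)' = u' ∑ (1 − u)^k. Multiplying by u sums
the geometric series, and u' differs from u by a single monomial, so u · (log u − X)' vanishes to
the required order. Since u has constant term 1, it is coprime to X and can be cancelled. -/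
theorem X_pow_dvd_logSum_expSum_sub_X [CharZero K] (n : ℕ) :
    (X : K[X]) ^ n ∣ logSum K (expSum K X n) n - X := by
  obtain _ | n := n
  · simp
  set u : K[X] := expSum K X (n + 1) with hu
  have hX : X ∣ 1 - u := X_dvd_one_sub_expSum n
  refine X_pow_succ_dvd_of_derivative ?_ ?_
  · rw [← X_dvd_iff]
    refine dvd_sub (dvd_neg.mpr (Finset.dvd_sum fun k _ => ?_)) dvd_rfl
    rw [smul_eq_C_mul]
    exact Dvd.dvd.mul_left (dvd_pow hX k.succ_ne_zero) _
  · have hcop : IsCoprime (X ^ n : K[X]) u := by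
      refine IsCoprime.pow_left ?_
      obtain ⟨v, hv⟩ := hX
      exact ⟨v, 1, by rw [mul_comm v, ← hv]; ring⟩
    refine hcop.dvd_of_dvd_mul_left ?_
    have hgeom : u * ∑ k ∈ Finset.range (n + 1), (1 - u) ^ k = 1 - (1 - u) ^ (n + 1) := by
      have := mul_neg_geom_sum (1 - u) (n + 1)
      rwa [sub_sub_cancel] at this
    have huu : u = expSum K X n + (n.factorial : K)⁻¹ • X ^ n := by
      rw [hu, expSum, Finset.sum_range_succ]; rfl
    have key : u * derivative (logSum K u (n + 1) - X) =
        -((n.factorial : K)⁻¹ • X ^ n) - (1 - u) ^ (n + 1) * expSum K X n := by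
      rw [derivative_sub, derivative_logSum, derivative_X, mul_sub, ← mul_assoc, hgeom, hu,
        derivative_expSum, ← hu]
      linear_combination (-1 : K[X]) * huu
    rw [key, smul_eq_C_mul]
    refine dvd_sub (dvd_neg.mpr (dvd_mul_left _ _)) (Dvd.dvd.mul_right ?_ _)
    exact (pow_dvd_pow _ n.le_succ).trans (pow_dvd_pow_of_dvd hX _)

theorem log_exp [CharZero K] (hF : IsCompleteFiltration F) {a : A} (ha : a ∈ F 1) :
    log F (exp F a) = a := by
  refine eq_of_forall_sub_mem hF fun n => ?_
  have h1 := logSum_sub_log_mem hF (exp_sub_one_mem hF ha) n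
  have h2 := aeval_mem hF ha (X_pow_dvd_logSum_expSum_sub_X (K := K) n)
  rw [map_sub, map_logSum, map_expSum, aeval_X] at h2
  have h3 : logSum K (expSum K a n) n - logSum K (exp F a) n ∈ F n := by
    have hpow : ∀ k, (1 - exp F a) ^ k - (1 - expSum K a n) ^ k ∈ F n := by
      intro k
      induction k with
      | zero => simp
      | succ k ih =>
        rw [pow_succ, pow_succ]
        refine mul_sub_mul_mem hF ih ?_
        simpa using expSum_sub_exp_mem hF ha n
    have : logSum K (expSum K a n) n - logSum K (exp F a) n =
        ∑ k ∈ Finset.range n, ((k + 1 : ℕ) : K)⁻¹ •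
          ((1 - exp F a) ^ (k + 1) - (1 - expSum K a n) ^ (k + 1)) := by
      simp only [logSum, smul_sub, Finset.sum_sub_distrib]
      abel
    rw [this]
    exact Submodule.sum_mem _ fun k _ => Submodule.smul_mem _ _ (hpow _)
  convert (F n).neg_mem ((F n).sub_mem ((F n).add_mem h3 h1) h2) using 1
  abel

/-- Both sides have the same logarithm by `log_exp`, and log is injective; no second formal identity
is required. -/
theorem exp_log [CharZero K] (hF : IsCompleteFiltration F) {b : A} (hb : b - 1 ∈ F 1) :
    exp F (log F b) = b :=
  log_injOn hF (exp_sub_one_mem hF (log_mem hF hb)) hb (log_exp hF (log_mem hF hb))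

theorem expSum_smul_eq_aeval [CharZero K] (t : K) (a : A) (n : ℕ) :
    expSum K (t • a) n =
      aeval a (PowerSeries.trunc n (PowerSeries.rescale t (PowerSeries.exp K))) := by
  rw [aeval_def, PowerSeries.eval₂_trunc_eq_sum_range, expSum]
  refine Finset.sum_congr rfl fun k _ => ?_
  rw [PowerSeries.coeff_rescale, PowerSeries.coeff_exp, ← Algebra.smul_def, _root_.smul_pow, smul_smul,
    mul_comm]
  simp

theorem exp_smul_mul_exp_smul [CharZero K] (hF : IsCompleteFiltration F) (s t : K) {a : A}
    (ha : a ∈ F 1) : exp F (s • a) * exp F (t • a) = exp F ((s + t) • a) := by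
  refine eq_of_forall_sub_mem hF fun n => ?_
  have h (r : K) := expSum_sub_exp_mem hF ((F 1).smul_mem r ha) n
  have h1 := mul_sub_mul_mem hF (h s) (h t)
  have h2 : expSum K (s • a) n * expSum K (t • a) n - expSum K ((s + t) • a) n ∈ F n := by
    rw [expSum_smul_eq_aeval, expSum_smul_eq_aeval, expSum_smul_eq_aeval, ← map_mul, ← map_sub]
    refine aeval_mem hF ha ?_
    rw [X_pow_dvd_iff]
    intro d hd
    rw [coeff_sub, sub_eq_zero, ← PowerSeries.exp_mul_exp_eq_exp_add, PowerSeries.coeff_trunc,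
      if_pos hd, PowerSeries.coeff_mul_eq_coeff_trunc_mul_trunc _ _ hd, ← coeff_coe, coe_mul]
  have := (F n).add_mem ((F n).sub_mem h2 h1) (h (s + t))
  convert this using 1
  abel

theorem exp_mul_exp_neg [CharZero K] (hF : IsCompleteFiltration F) {a : A} (ha : a ∈ F 1) :
    exp F a * exp F (-a) = 1 := by
  have := exp_smul_mul_exp_smul hF (1 : K) (-1) ha
  rwa [one_smul, neg_one_smul, add_neg_cancel, zero_smul, exp_zero hF] at this

theorem exp_neg_mul_exp [CharZero K] (hF : IsCompleteFiltration F) {a : A} (ha : a ∈ F 1) :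
    exp F (-a) * exp F a = 1 := by
  have := exp_mul_exp_neg hF ((F 1).neg_mem ha)
  rwa [neg_neg] at this

theorem exp_natCast_smul [CharZero K] (hF : IsCompleteFiltration F) {a : A} (ha : a ∈ F 1)
    (n : ℕ) : exp F ((n : K) • a) = exp F a ^ n := by
  induction n with
  | zero => simp [exp_zero hF]
  | succ n ih =>
    have := exp_smul_mul_exp_smul hF (n : K) 1 ha
    rw [pow_succ, ← ih, Nat.cast_succ, ← this, one_smul]

/-- Square roots in `1 + A₁` are unique. -/
theorem eq_of_mul_self_eq [CharZero K] (hF : IsCompleteFiltration F) {a b : A}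
    (ha : a - 1 ∈ F 1) (hb : b - 1 ∈ F 1) (h : a * a = b * b) : a = b := by
  -- The square of c determines 2 log c, hence log c, hence c.
  have sq : ∀ c : A, c - 1 ∈ F 1 → exp F ((2 : K) • log F c) = c * c := fun c hc => by
    have := exp_natCast_smul hF (log_mem hF hc) 2
    rw [exp_log hF hc] at this
    rw [← sq, ← this, Nat.cast_ofNat]
  have h2 := exp_injOn hF ((F 1).smul_mem (2 : K) (log_mem hF ha))
    ((F 1).smul_mem (2 : K) (log_mem hF hb)) (by rw [sq a ha, sq b hb, h])
  exact log_injOn hF ha hb (smul_right_injective A (two_ne_zero (α := K)) h2)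

/-! ### The BCH-recursion -/

theorem exp_mul_exp_sub_one_mem (hF : IsCompleteFiltration F) {x y : A} (hx : x ∈ F 1)
    (hy : y ∈ F 1) : exp F x * exp F y - 1 ∈ F 1 :=
  mul_sub_one_mem hF (exp_sub_one_mem hF hx) (exp_sub_one_mem hF hy)

/-- `BCH` is contracting for the filtration. -/
theorem BCH_sub_BCH_mem (hF : IsCompleteFiltration F) {n : ℕ} {x x' y y' : A} (hx : x ∈ F 1)
    (hx' : x' ∈ F 1) (hy : y ∈ F 1) (hy' : y' ∈ F 1) (hxx : x - x' ∈ F n) (hyy : y - y' ∈ F n) :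
    BCH F x y - BCH F x' y' ∈ F (n + 1) := by
  have ex := exp_sub_exp_sub_mem hF hx hx' hxx
  have ey := exp_sub_exp_sub_mem hF hy hy' hyy
  have ex0 : exp F x - exp F x' ∈ F n := by
    simpa using (F n).add_mem (hF.anti n.le_succ ex) hxx
  have ey0 : exp F y - exp F y' ∈ F n := by
    simpa using (F n).add_mem (hF.anti n.le_succ ey) hyy
  -- Write eˣeʸ − eˣ′eʸ′ as (eˣ − eˣ′)(eʸ − 1) + (eˣ′ − 1)(eʸ − eʸ′) + (eˣ − eˣ′) + (eʸ − eʸ′). The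
  -- products gain a degree; the last two terms cancel, up to `F (n + 1)`, against the linear terms
  -- removed in `BCH`.
  have m1 := hF.mul_mem _ _ _ _ ex0 (exp_sub_one_mem hF hy)
  have m2 := hF.mul_mem _ _ _ _ (exp_sub_one_mem hF hx') ey0
  rw [add_comm 1 n] at m2
  have l := log_sub_log_sub_mem hF (exp_mul_exp_sub_one_mem hF hx hy)
    (exp_mul_exp_sub_one_mem hF hx' hy') (mul_sub_mul_mem hF ex0 ey0)
  have := (F (n + 1)).add_mem ((F _).add_mem l ((F _).add_mem m1 m2)) ((F _).add_mem ex ey)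
  convert this using 1
  simp only [BCH, C]
  noncomm_ring

/-- A solution `b` of `C (P b, (id - P) b) = a` is the limit of the BCH-recursion. -/
theorem converges_chiSeq (hF : IsCompleteFiltration F) {P : A →ₗ[K] A}
    (hP : ∀ n, ∀ a ∈ F n, P a ∈ F n) {a b : A} (ha : a ∈ F 1) (hb : b ∈ F 1)
    (hab : C F (P b) (b - P b) = a) : Converges F (chiSeq F P a) b := by
  have key : ∀ n, chiSeq F P a n - b ∈ F (n + 1) := by
    intro n
    induction n with
    | zero => exact (F 1).sub_mem ha hb
    | succ n ih =>
      have hc : chiSeq F P a n ∈ F 1 := by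
        simpa using (F 1).add_mem (hF.anti (by omega) ih) hb
      have hd := hP _ _ ih
      rw [map_sub] at hd
      have h := BCH_sub_BCH_mem hF (hP 1 _ hb) (hP 1 _ hc) ((F 1).sub_mem hb (hP 1 _ hb))
        ((F 1).sub_mem hc (hP 1 _ hc)) (by simpa using (F _).neg_mem hd)
        (by convert (F (n + 1)).sub_mem hd ih using 1; abel)
      convert h using 1
      simp only [chiSeq, LinearMap.sub_apply, LinearMap.id_apply]
      -- The hypothesis on b says b = a − BCH(P b, b − P b), so the error at step n + 1 is a
      -- difference of two `BCH` values.
      rw [BCH.eq_1 F (P b), hab]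
      abel
  exact fun n => ⟨n, fun m hm => hF.anti (by omega) (key m)⟩

end FilteredAlg
namespace GradedHopf

open FilteredAlg

variable {K H : Type*} [Field K] [Ring H] [HopfAlgebra K H]
variable (𝒜 : ℕ → Submodule K H) [GradedAlgebra 𝒜]

/-! ### The grading involution -/

theorem hom_ext_of_graded {M : Type*} [AddCommGroup M] [Module K M] {f g : H →ₗ[K] M}
    (h : ∀ n, ∀ x ∈ 𝒜 n, f x = g x) : f = g := by
  ext x
  induction x using DirectSum.Decomposition.inductionOn 𝒜 with
  | zero => simp
  | homogeneous a => exact h _ _ a.2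
  | add a b ha hb => rw [map_add, map_add, ha, hb]

theorem bar_apply {n : ℕ} {x : H} (hx : x ∈ 𝒜 n) : bar 𝒜 x = (-1 : K) ^ n • x :=
  degreeScale_apply 𝒜 _ hx

theorem evenProj_add_oddProj : evenProj 𝒜 + oddProj 𝒜 = LinearMap.id := by
  refine hom_ext_of_graded 𝒜 fun n x hx => ?_
  rw [LinearMap.add_apply, evenProj, oddProj, degreeScale_apply 𝒜 _ hx, degreeScale_apply 𝒜 _ hx]
  rcases Nat.even_or_odd n with h | h
  · simp [h, Nat.not_odd_iff_even.mpr h]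
  · simp [h, Nat.not_even_iff_odd.mpr h]

theorem evenProj_sub_oddProj : evenProj 𝒜 - oddProj 𝒜 = bar 𝒜 := by
  refine hom_ext_of_graded 𝒜 fun n x hx => ?_
  rw [LinearMap.sub_apply, evenProj, oddProj, degreeScale_apply 𝒜 _ hx, degreeScale_apply 𝒜 _ hx,
    bar_apply 𝒜 hx]
  rcases Nat.even_or_odd n with h | h
  · simp [h, Nat.not_odd_iff_even.mpr h]
  · simp [h, Nat.not_even_iff_odd.mpr h]

theorem bar_bar (x : H) : bar 𝒜 (bar 𝒜 x) = x := by
  have : bar 𝒜 ∘ₗ bar 𝒜 = LinearMap.id := by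
    refine hom_ext_of_graded 𝒜 fun n x hx => ?_
    rw [LinearMap.comp_apply, bar_apply 𝒜 hx, map_smul, bar_apply 𝒜 hx, smul_smul,
      ← mul_pow]
    simp
  exact LinearMap.congr_fun this x

theorem bar_one : bar 𝒜 1 = 1 := by
  simp [bar_apply 𝒜 SetLike.GradedOne.one_mem]

theorem bar_mul (x y : H) : bar 𝒜 (x * y) = bar 𝒜 x * bar 𝒜 y := by
  have : (LinearMap.mul K H).compr₂ (bar 𝒜) = (LinearMap.mul K H).compl₁₂ (bar 𝒜) (bar 𝒜) := by
    refine hom_ext_of_graded 𝒜 fun m x hx => hom_ext_of_graded 𝒜 fun n y hy => ?_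
    simp only [LinearMap.compr₂_apply, LinearMap.compl₁₂_apply, LinearMap.mul_apply',
      bar_apply 𝒜 hx, bar_apply 𝒜 hy, bar_apply 𝒜 (SetLike.mul_mem_graded hx hy)]
    rw [smul_mul_smul_comm, pow_add]
  exact LinearMap.congr_fun₂ this x y

variable {𝒜} in
theorem counit_bar (h𝒜 : IsConnectedGraded 𝒜) (x : H) :
    Coalgebra.counit (R := K) (bar 𝒜 x) = Coalgebra.counit (R := K) x := by
  have : Coalgebra.counit (R := K) ∘ₗ bar 𝒜 = Coalgebra.counit := by
    refine hom_ext_of_graded 𝒜 fun n x hx => ?_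
    rw [LinearMap.comp_apply, bar_apply 𝒜 hx, map_smul]
    rcases eq_or_ne n 0 with rfl | hn
    · simp
    · simp [h𝒜.counit_eq_zero n hn x hx]
  exact LinearMap.congr_fun this x

variable {𝒜} in
-- Homogeneity of the coproduct: on bidegree (p, q) with p + q = n, the sign (−1)ⁿ splits as
-- (−1)ᵖ(−1)^q.
theorem comul_bar (h𝒜 : IsConnectedGraded 𝒜) (x : H) :
    Coalgebra.comul (R := K) (bar 𝒜 x) =
      TensorProduct.map (bar 𝒜) (bar 𝒜) (Coalgebra.comul (R := K) x) := by
  have : Coalgebra.comul (R := K) ∘ₗ bar 𝒜 =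
      TensorProduct.map (bar 𝒜) (bar 𝒜) ∘ₗ Coalgebra.comul := by
    refine hom_ext_of_graded 𝒜 fun n x hx => ?_
    rw [LinearMap.comp_apply, LinearMap.comp_apply, bar_apply 𝒜 hx, map_smul]
    have hle : (⨆ p ∈ Finset.HasAntidiagonal.antidiagonal n,
        LinearMap.range (TensorProduct.map (𝒜 p.1).subtype (𝒜 p.2).subtype)) ≤
        LinearMap.ker (TensorProduct.map (bar 𝒜) (bar 𝒜) - (-1 : K) ^ n • LinearMap.id) := by
      refine iSup₂_le fun p hp => ?_
      rw [LinearMap.range_le_ker_iff]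
      ext a b
      have hpi := Finset.HasAntidiagonal.mem_antidiagonal.mp hp
      simp [bar_apply 𝒜 a.2, bar_apply 𝒜 b.2, ← hpi, pow_add]
      rw [← TensorProduct.smul_tmul', smul_smul, mul_comm, sub_self]
    have := hle (h𝒜.comul_mem n x hx)
    rw [LinearMap.mem_ker, LinearMap.sub_apply, sub_eq_zero] at this
    exact this.symm
  exact LinearMap.congr_fun this x

variable {𝒜} in
/-- Precomposition with the grading involution is an endomorphism of the convolution algebra. -/
noncomputable def barHom (h𝒜 : IsConnectedGraded 𝒜) : Dual K H →ₐ[K] Dual K H :=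
  AlgHom.ofLinearMap (precomp (bar 𝒜))
    (WithConv.ext (LinearMap.ext fun x => counit_bar h𝒜 x))
    (fun f g => WithConv.ext (LinearMap.ext fun x => by
      change LinearMap.mul' K K (TensorProduct.map f.ofConv g.ofConv (Coalgebra.comul (bar 𝒜 x))) =
        LinearMap.mul' K K (TensorProduct.map (f.ofConv ∘ₗ bar 𝒜) (g.ofConv ∘ₗ bar 𝒜)
          (Coalgebra.comul x))
      rw [comul_bar h𝒜, TensorProduct.map_comp]
      rfl))

theorem precomp_degreeScale_mem (c : ℕ → K) (n : ℕ) (f : Dual K H) (hf : f ∈ dualFiltration 𝒜 n) :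
    precomp (degreeScale 𝒜 c) f ∈ dualFiltration 𝒜 n := by
  intro i hi x hx
  change f (degreeScale 𝒜 c x) = 0
  rw [degreeScale_apply 𝒜 c hx, map_smul, hf i hi x hx, smul_zero]

variable {𝒜} in
theorem barHom_mem (h𝒜 : IsConnectedGraded 𝒜) (n : ℕ) (f : Dual K H)
    (hf : f ∈ dualFiltration 𝒜 n) : barHom h𝒜 f ∈ dualFiltration 𝒜 n :=
  precomp_degreeScale_mem 𝒜 _ n f hf

variable {𝒜} in
theorem barHom_barHom (h𝒜 : IsConnectedGraded 𝒜) (f : Dual K H) :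
    barHom h𝒜 (barHom h𝒜 f) = f :=
  WithConv.ext (LinearMap.ext fun x => congrArg f.ofConv (bar_bar 𝒜 x))

variable {𝒜} in
theorem precomp_even_add_odd (f : Dual K H) :
    precomp (evenProj 𝒜) f + precomp (oddProj 𝒜) f = f := by
  refine WithConv.ext (LinearMap.ext fun x => ?_)
  change f (evenProj 𝒜 x) + f (oddProj 𝒜 x) = f x
  rw [← map_add, ← LinearMap.add_apply, evenProj_add_oddProj, LinearMap.id_apply]

variable {𝒜} in
theorem precomp_even_sub_odd (h𝒜 : IsConnectedGraded 𝒜) (f : Dual K H) :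
    precomp (evenProj 𝒜) f - precomp (oddProj 𝒜) f = barHom h𝒜 f := by
  refine WithConv.ext (LinearMap.ext fun x => ?_)
  change f (evenProj 𝒜 x) - f (oddProj 𝒜 x) = f (bar 𝒜 x)
  rw [← map_sub, ← LinearMap.sub_apply, evenProj_sub_oddProj]

section CharZero

variable [CharZero K] {𝒜} (h𝒜 : IsConnectedGraded 𝒜)
include h𝒜

/-- Twice the even part is f + f̄, and 2 is invertible. -/
theorem precomp_even_eq_zero {f : Dual K H} (hf : barHom h𝒜 f = -f) :
    precomp (evenProj 𝒜) f = 0 := by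
  have h1 := precomp_even_add_odd (𝒜 := 𝒜) f
  have h2 := precomp_even_sub_odd h𝒜 f
  have : (2 : K) • precomp (evenProj 𝒜) f = 0 := by
    calc _ = _ := two_smul K _
      _ = (precomp (evenProj 𝒜) f + precomp (oddProj 𝒜) f) +
          (precomp (evenProj 𝒜) f - precomp (oddProj 𝒜) f) := by abel
      _ = 0 := by rw [h1, h2, hf, add_neg_cancel]
  exact (smul_eq_zero.mp this).resolve_left two_ne_zero

theorem precomp_odd_eq_zero {f : Dual K H} (hf : barHom h𝒜 f = f) :
    precomp (oddProj 𝒜) f = 0 := by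
  have h1 := precomp_even_add_odd (𝒜 := 𝒜) f
  have h2 := precomp_even_sub_odd h𝒜 f
  have : (2 : K) • precomp (oddProj 𝒜) f = 0 := by
    calc _ = _ := two_smul K _
      _ = (precomp (evenProj 𝒜) f + precomp (oddProj 𝒜) f) -
          (precomp (evenProj 𝒜) f - precomp (oddProj 𝒜) f) := by abel
      _ = 0 := by rw [h1, h2, hf, sub_self]
  exact (smul_eq_zero.mp this).resolve_left two_ne_zero

end CharZero
end GradedHopf
namespace GradedHopf

open FilteredAlg

variable {K H : Type*} [Field K] [Ring H] [HopfAlgebra K H]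
variable {𝒜 : ℕ → Submodule K H} [GradedAlgebra 𝒜]

/-! ### Characters and infinitesimal characters -/

theorem Character.toDual_injective :
    Function.Injective (Character.toDual : Character K H → Dual K H) := by
  intro φ ψ h
  refine WithConv.ext (AlgHom.toLinearMap_injective ?_)
  exact congrArg WithConv.ofConv h

theorem Character.toDual_mul (φ ψ : Character K H) :
    (φ * ψ).toDual = φ.toDual * ψ.toDual := rfl

theorem Character.toDual_apply_one (φ : Character K H) : φ.toDual (1 : H) = 1 :=
  map_one φ.ofConv

theorem Character.toDual_apply_mul (φ : Character K H) (x y : H) :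
    φ.toDual (x * y) = φ.toDual x * φ.toDual y := map_mul φ.ofConv x y

theorem exists_character_of_map_mul {f : Dual K H} (h1 : f (1 : H) = 1)
    (hmul : ∀ x y : H, f (x * y) = f x * f y) : ∃ φ : Character K H, φ.toDual = f :=
  ⟨WithConv.toConv (AlgHom.ofLinearMap f.ofConv h1 hmul), rfl⟩

variable (𝒜) in
theorem exists_character_toDual_eq_bar (φ : Character K H) :
    ∃ ψ : Character K H, ψ.toDual = precomp (bar 𝒜) φ.toDual := by
  refine exists_character_of_map_mul ?_ fun x y => ?_
  · change φ.toDual (bar 𝒜 1) = 1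
    rw [bar_one, φ.toDual_apply_one]
  · change φ.toDual (bar 𝒜 (x * y)) = φ.toDual (bar 𝒜 x) * φ.toDual (bar 𝒜 y)
    rw [bar_mul, φ.toDual_apply_mul]

/-- This is where connectedness enters: degree 0 is spanned by 1. -/
theorem mem_dualFiltration_one (h𝒜 : IsConnectedGraded 𝒜) {f : Dual K H} :
    f ∈ dualFiltration 𝒜 1 ↔ f (1 : H) = 0 := by
  constructor
  · exact fun hf => hf 0 one_pos 1 SetLike.GradedOne.one_mem
  · intro hf i hi x hx
    obtain rfl : i = 0 := by omega
    rw [h𝒜.connected] at hx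
    obtain ⟨c, rfl⟩ := Submodule.mem_span_singleton.mp hx
    rw [map_smul, hf, smul_zero]

theorem Character.toDual_sub_one_mem (h𝒜 : IsConnectedGraded 𝒜) (φ : Character K H) :
    φ.toDual - 1 ∈ dualFiltration 𝒜 1 := by
  rw [mem_dualFiltration_one h𝒜]
  change φ.toDual (1 : H) - algebraMap K K (Coalgebra.counit (R := K) (1 : H)) = 0
  rw [φ.toDual_apply_one, Bialgebra.counit_one, map_one, sub_self]

theorem infChar_le_dualFiltration_one (h𝒜 : IsConnectedGraded 𝒜) :
    infChar K H ≤ dualFiltration 𝒜 1 := by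
  intro Z hZ
  rw [mem_dualFiltration_one h𝒜]
  have := hZ 1 1
  simpa using this

variable (𝒜) in
-- An element has finitely many homogeneous components, so a convergent series evaluated at it is a
-- finite sum.
theorem exists_forall_mem_dualFiltration_apply_eq_zero (x : H) :
    ∃ N, ∀ n, N ≤ n → ∀ f ∈ dualFiltration 𝒜 n, f x = 0 := by
  induction x using DirectSum.Decomposition.inductionOn 𝒜 with
  | zero => exact ⟨0, fun _ _ f _ => map_zero f.ofConv⟩
  | @homogeneous i a => exact ⟨i + 1, fun n hn f hf => hf i hn a a.2⟩
  | add a b ha hb =>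
    obtain ⟨M, hM⟩ := ha
    obtain ⟨N, hN⟩ := hb
    refine ⟨max M N, fun n hn f hf => ?_⟩
    rw [map_add, hM n (le_trans (le_max_left _ _) hn) f hf,
      hN n (le_trans (le_max_right _ _) hn) f hf, add_zero]

/-- On a given element of `H`, the one-parameter group `exp (t Z)` is polynomial in `t`. -/
theorem exists_polynomial_eval_eq_exp_smul (h𝒜 : IsConnectedGraded 𝒜) {Z : Dual K H}
    (hZ : Z ∈ dualFiltration 𝒜 1) (x : H) : ∃ p : Polynomial K,
      (∀ t : K, exp (dualFiltration 𝒜) (t • Z) x = p.eval t) ∧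
        p.coeff 0 = Coalgebra.counit (R := K) x ∧ p.coeff 1 = Z x := by
  have hF := dualFiltration_isComplete 𝒜 h𝒜
  obtain ⟨N, hN⟩ := exists_forall_mem_dualFiltration_apply_eq_zero 𝒜 x
  -- The `+ 2` guarantees that the coefficients of degree 0 and 1 can be read off even when `N = 0`.
  have hcoeff : ∀ d < N + 2, (∑ k ∈ Finset.range (N + 2),
      Polynomial.monomial k ((k.factorial : K)⁻¹ * (Z ^ k) x)).coeff d =
        (d.factorial : K)⁻¹ * (Z ^ d) x := by
    intro d hd
    rw [Polynomial.finsetSum_coeff]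
    simp [Polynomial.coeff_monomial, hd]
  refine ⟨∑ k ∈ Finset.range (N + 2), Polynomial.monomial k ((k.factorial : K)⁻¹ * (Z ^ k) x),
    fun t => ?_, ?_, ?_⟩
  · have h := hN (N + 2) (by omega) _ (expSum_sub_exp_mem hF ((dualFiltration 𝒜 1).smul_mem t hZ)
      (N + 2))
    rw [WithConv.ofConv_sub, LinearMap.sub_apply, sub_eq_zero] at h
    rw [← h, expSum, WithConv.ofConv_sum, LinearMap.sum_apply, Polynomial.eval_finsetSum]
    refine Finset.sum_congr rfl fun k _ => ?_
    rw [Polynomial.eval_monomial, smul_pow]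
    simp
    ring
  · rw [hcoeff 0 (by omega)]
    simp
  · rw [hcoeff 1 (by omega)]
    simp

theorem log_toDual_mem (h𝒜 : IsConnectedGraded 𝒜) (φ : Character K H) :
    log (dualFiltration 𝒜) φ.toDual ∈ dualFiltration 𝒜 1 :=
  log_mem (dualFiltration_isComplete 𝒜 h𝒜) (φ.toDual_sub_one_mem h𝒜)

theorem barHom_exp (h𝒜 : IsConnectedGraded 𝒜) {Z : Dual K H} (hZ : Z ∈ dualFiltration 𝒜 1) :
    barHom h𝒜 (exp (dualFiltration 𝒜) Z) = exp (dualFiltration 𝒜) (barHom h𝒜 Z) :=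
  map_exp (dualFiltration_isComplete 𝒜 h𝒜) _ (barHom_mem h𝒜) hZ

/-- Bar commutes with exp, which is injective on A₁, so parity of a character is a linear condition
on its logarithm. -/
theorem isEven_iff_barHom (h𝒜 : IsConnectedGraded 𝒜) {X : Dual K H}
    (hX : X ∈ dualFiltration 𝒜 1) {φ : Character K H} (hφ : exp (dualFiltration 𝒜) X = φ.toDual) :
    IsEven 𝒜 φ ↔ barHom h𝒜 X = X := by
  have hF := dualFiltration_isComplete 𝒜 h𝒜
  rw [IsEven, ← hφ]
  change barHom h𝒜 (exp (dualFiltration 𝒜) X) = _ ↔ _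
  rw [barHom_exp h𝒜 hX]
  exact ⟨exp_injOn hF (barHom_mem h𝒜 1 X hX) hX, fun h => by rw [h]⟩

/-- In a factorization `φ = φ₋ ⋆ φ₊`, the odd factor is a square root of `φ ⋆ φ̄⁻¹`. -/
theorem IsOddEvenFactorization.mul_self_mul_bar (h𝒜 : IsConnectedGraded 𝒜)
    {φ : Character K H}
    {p : Character K H × Character K H} (h : IsOddEvenFactorization 𝒜 φ p) :
    p.1.toDual * p.1.toDual * barHom h𝒜 φ.toDual = φ.toDual := by
  obtain ⟨h1, h2, rfl⟩ := h
  have h1' : barHom h𝒜 p.1.toDual = precomp (HopfAlgebra.antipode K) p.1.toDual := h1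
  have h2' : barHom h𝒜 p.2.toDual = p.2.toDual := h2
  rw [Character.toDual_mul, map_mul, h1', h2', mul_assoc, ← mul_assoc _ _ p.2.toDual,
    (toDual_mul_antipode p.1).1, one_mul]

section CharZero

variable [CharZero K] (h𝒜 : IsConnectedGraded 𝒜)
include h𝒜

/-- If `exp Z` is a character then `exp (t Z)` is multiplicative for all `t`, as a polynomial
identity in `t`, and `Z` is an infinitesimal character. -/
theorem exp_smul_map_mul_and_mem_infChar {Z : Dual K H} (hZ : Z ∈ dualFiltration 𝒜 1)
    {φ : Character K H} (hφ : exp (dualFiltration 𝒜) Z = φ.toDual) :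
    (∀ (t : K) (x y : H), exp (dualFiltration 𝒜) (t • Z) (x * y) =
      exp (dualFiltration 𝒜) (t • Z) x * exp (dualFiltration 𝒜) (t • Z) y) ∧
        Z ∈ infChar K H := by
  have hF := dualFiltration_isComplete 𝒜 h𝒜
  choose p hp hp0 hp1 using exists_polynomial_eval_eq_exp_smul h𝒜 hZ
  have hpow : ∀ n : ℕ, exp (dualFiltration 𝒜) ((n : K) • Z) = (φ ^ n).toDual := by
    intro n
    rw [exp_natCast_smul hF hZ, hφ]
    exact (AlgHom.toLinearMap_convPow φ n).symm
  -- Both polynomials agree at every natural number, an infinite set in characteristic zero.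
  have key : ∀ x y, p (x * y) = p x * p y := by
    intro x y
    refine Polynomial.eq_of_infinite_eval_eq _ _
      ((Set.infinite_range_of_injective (Nat.cast_injective (R := K))).mono ?_)
    rintro _ ⟨n, rfl⟩
    rw [Set.mem_ofPred_eq, Polynomial.eval_mul, ← hp, ← hp, ← hp, hpow,
      Character.toDual_apply_mul]
  refine ⟨fun t x y => ?_, fun x y => ?_⟩
  · rw [hp, hp, hp, key, Polynomial.eval_mul]
  -- Comparing coefficients of t differentiates multiplicativity at t = 0.
  · rw [← hp1, key, Polynomial.mul_coeff_one, hp0, hp0, hp1, hp1, add_comm]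

theorem mem_infChar_of_exp_eq {Z : Dual K H} (hZ : Z ∈ dualFiltration 𝒜 1)
    {φ : Character K H} (hφ : exp (dualFiltration 𝒜) Z = φ.toDual) : Z ∈ infChar K H :=
  (exp_smul_map_mul_and_mem_infChar h𝒜 hZ hφ).2

/-- Used with t = 1/2 for square roots and t = −1 for inverses, which therefore stay among the
characters. -/
theorem exists_character_eq_exp_smul {Z : Dual K H} (hZ : Z ∈ dualFiltration 𝒜 1)
    {φ : Character K H} (hφ : exp (dualFiltration 𝒜) Z = φ.toDual) (t : K) :
    ∃ ψ : Character K H, ψ.toDual = exp (dualFiltration 𝒜) (t • Z) := by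
  have hF := dualFiltration_isComplete 𝒜 h𝒜
  refine exists_character_of_map_mul ?_ ((exp_smul_map_mul_and_mem_infChar h𝒜 hZ hφ).1 t)
  have := (mem_dualFiltration_one h𝒜).mp
    (exp_sub_one_mem hF ((dualFiltration 𝒜 1).smul_mem t hZ))
  rw [WithConv.ofConv_sub, LinearMap.sub_apply, sub_eq_zero] at this
  rw [this, LinearMap.convOne_apply, Bialgebra.counit_one, map_one]

theorem exp_log_toDual (φ : Character K H) :
    exp (dualFiltration 𝒜) (log (dualFiltration 𝒜) φ.toDual) = φ.toDual :=
  exp_log (dualFiltration_isComplete 𝒜 h𝒜) (φ.toDual_sub_one_mem h𝒜)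

theorem log_toDual_mem_infChar (φ : Character K H) :
    log (dualFiltration 𝒜) φ.toDual ∈ infChar K H :=
  mem_infChar_of_exp_eq h𝒜 (log_toDual_mem h𝒜 φ) (exp_log_toDual h𝒜 φ)

/-- Both sides are convolution inverses of φ. -/
theorem precomp_antipode_eq_exp_neg {X : Dual K H} (hX : X ∈ dualFiltration 𝒜 1)
    {φ : Character K H} (hφ : exp (dualFiltration 𝒜) X = φ.toDual) :
    precomp (HopfAlgebra.antipode K) φ.toDual = exp (dualFiltration 𝒜) (-X) := by
  refine left_inv_eq_right_inv (toDual_mul_antipode φ).2 ?_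
  rw [← hφ, exp_mul_exp_neg (dualFiltration_isComplete 𝒜 h𝒜) hX]

theorem isOdd_iff_barHom {X : Dual K H} (hX : X ∈ dualFiltration 𝒜 1)
    {φ : Character K H} (hφ : exp (dualFiltration 𝒜) X = φ.toDual) :
    IsOdd 𝒜 φ ↔ barHom h𝒜 X = -X := by
  have hF := dualFiltration_isComplete 𝒜 h𝒜
  rw [IsOdd, precomp_antipode_eq_exp_neg h𝒜 hX hφ, ← hφ]
  change barHom h𝒜 (exp (dualFiltration 𝒜) X) = _ ↔ _
  rw [barHom_exp h𝒜 hX]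
  exact ⟨exp_injOn hF (barHom_mem h𝒜 1 X hX) (Submodule.neg_mem _ hX), fun h => by rw [h]⟩

/-! ### The factorization -/

theorem IsOddEvenFactorization.unique {φ : Character K H} {p q : Character K H × Character K H}
    (hp : IsOddEvenFactorization 𝒜 φ p) (hq : IsOddEvenFactorization 𝒜 φ q) : p = q := by
  have hF := dualFiltration_isComplete 𝒜 h𝒜
  obtain ⟨ψ, hψ⟩ := exists_character_toDual_eq_bar 𝒜 φ
  have hψ' : barHom h𝒜 φ.toDual = ψ.toDual := hψ.symm
  have hpq := (hp.mul_self_mul_bar h𝒜).trans (hq.mul_self_mul_bar h𝒜).symm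
  rw [hψ'] at hpq
  have hsq := congrArg (· * precomp (HopfAlgebra.antipode K) ψ.toDual) hpq
  simp only [mul_assoc _ ψ.toDual, (toDual_mul_antipode ψ).1, mul_one] at hsq
  have h1 : p.1 = q.1 := Character.toDual_injective
    (eq_of_mul_self_eq hF (p.1.toDual_sub_one_mem h𝒜) (q.1.toDual_sub_one_mem h𝒜) hsq)
  refine Prod.ext h1 (Character.toDual_injective ?_)
  have h2 := congrArg (fun χ => precomp (HopfAlgebra.antipode K) p.1.toDual * Character.toDual χ)
    (hp.2.2.symm.trans hq.2.2)
  simpa only [← h1, Character.toDual_mul, ← mul_assoc, (toDual_mul_antipode p.1).2, one_mul]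
    using h2

theorem exists_isOddEvenFactorization (φ : Character K H) :
    ∃ p, IsOddEvenFactorization 𝒜 φ p := by
  have hF := dualFiltration_isComplete 𝒜 h𝒜
  obtain ⟨φ', hφ'⟩ := exists_character_toDual_eq_bar 𝒜 φ
  have hbar : barHom h𝒜 φ.toDual = φ'.toDual := hφ'.symm
  obtain ⟨φi, hφi⟩ := exists_character_eq_exp_smul h𝒜 (log_toDual_mem h𝒜 φ)
    (exp_log_toDual h𝒜 φ) (-1)
  obtain ⟨φi', hφi'⟩ := exists_character_toDual_eq_bar 𝒜 φi
  have hbari : barHom h𝒜 φi.toDual = φi'.toDual := hφi'.symm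
  have hinv : φi.toDual * φ.toDual = 1 := by
    rw [hφi, neg_one_smul, ← exp_log_toDual h𝒜 φ, log_exp hF (log_toDual_mem h𝒜 φ),
      exp_neg_mul_exp hF (log_toDual_mem h𝒜 φ)]
  have hinv2 : φ.toDual * φi.toDual = 1 := by
    rw [hφi, neg_one_smul, ← exp_log_toDual h𝒜 φ, log_exp hF (log_toDual_mem h𝒜 φ),
      exp_mul_exp_neg hF (log_toDual_mem h𝒜 φ)]
  have hinv' : φi'.toDual * φ'.toDual = 1 := by
    rw [← hbari, ← hbar, ← map_mul, hinv, map_one]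
  -- the square `φ ⋆ φ̄⁻¹` of the odd factor
  set ψ : Character K H := φ * φi' with hψ
  set W := log (dualFiltration 𝒜) ψ.toDual
  have hWm : W ∈ dualFiltration 𝒜 1 := log_toDual_mem h𝒜 ψ
  have hWe : exp (dualFiltration 𝒜) W = ψ.toDual := exp_log_toDual h𝒜 ψ
  have hψbar : ψ.toDual * φ'.toDual = φ.toDual := by
    rw [hψ, Character.toDual_mul, mul_assoc, hinv', mul_one]
  -- ψ̄ ⋆ ψ = φ̄ ⋆ φ⁻¹ ⋆ φ ⋆ φ̄⁻¹, which collapses.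
  have hψodd : barHom h𝒜 ψ.toDual * ψ.toDual = 1 := by
    rw [hψ, Character.toDual_mul, map_mul, ← hbari, barHom_barHom, mul_assoc,
      ← mul_assoc _ φ.toDual, hinv, one_mul, ← map_mul, hinv2, map_one]
  have hWodd : barHom h𝒜 W = -W := by
    refine exp_injOn hF (barHom_mem h𝒜 1 W hWm) (Submodule.neg_mem _ hWm) ?_
    rw [← barHom_exp h𝒜 hWm]
    refine left_inv_eq_right_inv (a := ψ.toDual) (by rw [hWe, hψodd]) ?_
    rw [← hWe, exp_mul_exp_neg hF hWm]
  set X : Dual K H := (2⁻¹ : K) • W with hX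
  have hXm : X ∈ dualFiltration 𝒜 1 := Submodule.smul_mem _ _ hWm
  obtain ⟨a, ha⟩ := exists_character_eq_exp_smul h𝒜 hWm hWe (2⁻¹ : K)
  obtain ⟨ai, hai⟩ := exists_character_eq_exp_smul h𝒜 hXm ha.symm (-1)
  rw [neg_one_smul] at hai
  have hsq : a.toDual * a.toDual = ψ.toDual := by
    rw [ha, exp_smul_mul_exp_smul hF _ _ hWm, ← two_mul, mul_inv_cancel₀ two_ne_zero, one_smul,
      hWe]
  have hXodd : barHom h𝒜 X = -X := by rw [hX, map_smul, hWodd, smul_neg]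
  have haia : ai.toDual * a.toDual = 1 := by rw [hai, ha, exp_neg_mul_exp hF hXm]
  have haai : a.toDual * ai.toDual = 1 := by rw [hai, ha, exp_mul_exp_neg hF hXm]
  refine ⟨(a, ai * φ), (isOdd_iff_barHom h𝒜 hXm ha.symm).mpr hXodd, ?_, ?_⟩
  · change barHom h𝒜 (ai * φ).toDual = (ai * φ).toDual
    have hbarai : barHom h𝒜 ai.toDual = a.toDual := by
      rw [hai, barHom_exp h𝒜 (Submodule.neg_mem _ hXm), map_neg, hXodd, neg_neg, ha]
    rw [Character.toDual_mul, map_mul, hbarai, hbar]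
    -- The bar of a⁻¹ ⋆ φ is a ⋆ φ̄ = a⁻¹ ⋆ a² ⋆ φ̄ = a⁻¹ ⋆ φ, since a² ⋆ φ̄ = ψ ⋆ φ̄ = φ.
    rw [← hψbar, ← hsq, ← mul_assoc, ← mul_assoc, haia, one_mul]
  · refine Character.toDual_injective ?_
    change φ.toDual = a.toDual * (ai.toDual * φ.toDual)
    rw [← mul_assoc, haai, one_mul]

/-- The sum of the logarithms of the factors is a fixed point of the BCH-recursion. -/
theorem IsOddEvenFactorization.converges_chiSeq {φ : Character K H}
    {p : Character K H × Character K H} (h : IsOddEvenFactorization 𝒜 φ p) {Z : Dual K H}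
    (hZ : Z ∈ infChar K H) (hexp : exp (dualFiltration 𝒜) Z = φ.toDual) :
    ∃ χ ∈ infChar K H,
      Converges (dualFiltration 𝒜) (chiSeq (dualFiltration 𝒜) (precomp (oddProj 𝒜)) Z) χ ∧
        p.1.toDual = exp (dualFiltration 𝒜) (precomp (oddProj 𝒜) χ) ∧
        p.2.toDual = exp (dualFiltration 𝒜) (precomp (evenProj 𝒜) χ) := by
  have hF := dualFiltration_isComplete 𝒜 h𝒜
  set X := log (dualFiltration 𝒜) p.1.toDual
  set Y := log (dualFiltration 𝒜) p.2.toDual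
  have hXm : X ∈ dualFiltration 𝒜 1 := log_toDual_mem h𝒜 p.1
  have hYm : Y ∈ dualFiltration 𝒜 1 := log_toDual_mem h𝒜 p.2
  have hXe : exp (dualFiltration 𝒜) X = p.1.toDual := exp_log_toDual h𝒜 p.1
  have hYe : exp (dualFiltration 𝒜) Y = p.2.toDual := exp_log_toDual h𝒜 p.2
  have hX0 := precomp_even_eq_zero h𝒜 ((isOdd_iff_barHom h𝒜 hXm hXe).mp h.1)
  have hY0 := precomp_odd_eq_zero h𝒜 ((isEven_iff_barHom h𝒜 hYm hYe).mp h.2.1)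
  have hX1 := precomp_even_add_odd (𝒜 := 𝒜) X
  have hY1 := precomp_even_add_odd (𝒜 := 𝒜) Y
  rw [hX0, zero_add] at hX1
  rw [hY0, add_zero] at hY1
  have hodd : precomp (oddProj 𝒜) (X + Y) = X := by rw [map_add, hX1, hY0, add_zero]
  have heven : precomp (evenProj 𝒜) (X + Y) = Y := by rw [map_add, hX0, hY1, zero_add]
  have hZm := infChar_le_dualFiltration_one h𝒜 hZ
  refine ⟨X + Y, Submodule.add_mem _ (log_toDual_mem_infChar h𝒜 p.1)
    (log_toDual_mem_infChar h𝒜 p.2), ?_, by rw [hodd, hXe], by rw [heven, hYe]⟩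
  refine FilteredAlg.converges_chiSeq (P := precomp (oddProj 𝒜)) hF
    (precomp_degreeScale_mem 𝒜 _) hZm (Submodule.add_mem _ hXm hYm) ?_
  -- Fixed-point equation: C(X, Y) = log(φ₋ ⋆ φ₊) = log φ = Z.
  rw [hodd, add_sub_cancel_left, C, hXe, hYe, ← Character.toDual_mul, ← h.2.2, ← hexp,
    log_exp hF hZm]

end CharZero
end GradedHopf

open GradedHopf
theorem mainTheorem6 {K H : Type*} [Field K] [CharZero K] [Ring H] [HopfAlgebra K H]
    (𝒜 : ℕ → Submodule K H) [GradedAlgebra 𝒜] (h𝒜 : IsConnectedGraded 𝒜)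
    (φ : Character K H) :
    (∃! p : Character K H × Character K H, IsOddEvenFactorization 𝒜 φ p) ∧
    (∃! Z : Dual K H, Z ∈ infChar K H ∧ FilteredAlg.exp (dualFiltration 𝒜) Z = φ.toDual) ∧
    ∀ Z ∈ infChar K H, FilteredAlg.exp (dualFiltration 𝒜) Z = φ.toDual →
      ∀ χ : Dual K H,
        χ = FilteredAlg.chi (dualFiltration 𝒜) (precomp (oddProj 𝒜)) Z →
        FilteredAlg.Converges (dualFiltration 𝒜)
          (FilteredAlg.chiSeq (dualFiltration 𝒜) (precomp (oddProj 𝒜)) Z) χ ∧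
        χ ∈ infChar K H ∧
        φ.toDual = FilteredAlg.exp (dualFiltration 𝒜) (precomp (oddProj 𝒜) χ) *
          FilteredAlg.exp (dualFiltration 𝒜) (precomp (evenProj 𝒜) χ) ∧
        ∀ p : Character K H × Character K H, IsOddEvenFactorization 𝒜 φ p →
          p.1.toDual = FilteredAlg.exp (dualFiltration 𝒜) (precomp (oddProj 𝒜) χ) ∧
          p.2.toDual = FilteredAlg.exp (dualFiltration 𝒜) (precomp (evenProj 𝒜) χ) := by
  have hF := dualFiltration_isComplete 𝒜 h𝒜
  obtain ⟨p, hp⟩ := exists_isOddEvenFactorization h𝒜 φ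
  refine ⟨⟨p, hp, fun q hq => hq.unique h𝒜 hp⟩,
    ⟨_, ⟨log_toDual_mem_infChar h𝒜 φ, exp_log_toDual h𝒜 φ⟩, fun Z hZ => ?_⟩, ?_⟩
  · exact FilteredAlg.exp_injOn hF (infChar_le_dualFiltration_one h𝒜 hZ.1)
      (log_toDual_mem h𝒜 φ) (hZ.2.trans (exp_log_toDual h𝒜 φ).symm)
  · rintro Z hZ hexp χ rfl
    obtain ⟨χ, hχ, hconv, h1, h2⟩ := hp.converges_chiSeq h𝒜 hZ hexp
    -- `chi` is a chosen limit; uniqueness of limits identifies it with the sum of the two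
    -- logarithms.
    rw [FilteredAlg.chi, FilteredAlg.limit_eq hF hconv]
    refine ⟨hconv, hχ, ?_, fun q hq => ?_⟩
    · rw [← h1, ← h2, ← Character.toDual_mul, ← hp.2.2]
    · obtain rfl := hq.unique h𝒜 hp
      exact ⟨h1, h2⟩
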